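/- Let $0<\kappa<8$, $a=2/\kappa$, $d=1+\kappa/8$, and let $\mathbb H=\{\operatorname{Im} z>0\}$. For $z\in\mathbb H$ let $$G(z)=(\operatorname{Im} z)^{d-2}\,[\sin\arg z]^{4a-1}$$ be the Green's function of chordal $SLE_\kappa$ from $0$ to $\infty$ in $\mathbb H$. For $z=x+iy\in\mathbb H$ let $L_z=[0,x]\cup[x,x+iy]$ (with $[x,0]$ in place of $[0,x]$ if $x\le 0$) and, for $\rho>0$, let $L_{z,\rho}=\{z'\in\overline{\mathbb H}:\operatorname{dist}(z',L_z)\le\rho|z|\}$. **Proposition.** For every $0<\rho\le 1/4$ there exists $0<c<\infty$, depending only on $\rho$ and $\kappa$, such that the following holds. Suppose $z\in\mathbb H$, $w\in\mathbb H\setminus L_{z,2\rho}$, and $\gamma:[0,T]\to\overline{\mathbb H}$ is a continuous curve with $\gamma(0)=0$, $\gamma(T)=z$ and $\gamma[0,T]\subset L_{z,\rho}$. Let $H_T$ be the unbounded connected component of $\mathbb H\setminus\gamma[0,T]$ and let $g:H_T\to\mathbb H$ be the corresponding Loewner map, that is, the conformal transformation of $H_T$ onto $\mathbb H$ with $g(\zeta)-\zeta\to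 0$ as $\zeta\to\infty$. Let $g(z)\in\mathbb R$ denote the boundary value of $g$ at the tip $z=\gamma(T)$ (for a Loewner curve this is the value $U_T$ of the driving function; more generally, any real number that is the limit of $g(\zeta_n)$ for some sequence $\zeta_n\in H_T$ with $\zeta_n\to z$ is allowed). Then $w\in H_T$, $$G\big(g(w)-g(z)\big)\ \ge\ c^{-1}\,G(w),\qquad c^{-1}\le|g'(w)|\le c .$$ -/

import Mathlib

open Set Filter Topology

namespace SLEGreen

/-- The open upper half plane `{z : 0 < Im z}`, as a subset of `ℂ`. -/
def halfPlane : Set ℂ := {z | 0 < z.im}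

/-- The closed upper half plane. -/
def closedHalfPlane : Set ℂ := {z | 0 ≤ z.im}

/-- The parameter `a = 2 / κ`. -/
noncomputable def aParam (κ : ℝ) : ℝ := 2 / κ

/-- The dimension `d = 1 + κ / 8` of the `SLE_κ` path. -/
noncomputable def dim (κ : ℝ) : ℝ := 1 + κ / 8

/-- The Green's function of chordal `SLE_κ` from `0` to `∞` in the upper half plane,
`G(z) = (Im z)^(d-2) * (sin (arg z))^(4a-1)`. -/
noncomputable def green (κ : ℝ) (z : ℂ) : ℝ :=
  z.im ^ (dim κ - 2) * Real.sin z.arg ^ (4 * aParam κ - 1)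

/-- The `L`-shape `L_z = [0, x] ∪ [x, x + iy]` for `z = x + iy`; the segment `[0, x]` is unoriented,
so that `x ≤ 0` is covered as well. -/
def lShape (z : ℂ) : Set ℂ := segment ℝ 0 (z.re : ℂ) ∪ segment ℝ (z.re : ℂ) z

/-- `L_{z,ρ}`, the points of the closed upper half plane at distance at most `ρ|z|` from `L_z`. -/
def lNhd (z : ℂ) (ρ : ℝ) : Set ℂ :=
  {z' | z' ∈ closedHalfPlane ∧ Metric.infDist z' (lShape z) ≤ ρ * ‖z‖}

/-- The unbounded connected component of `ℍ \ K`: the points of `ℍ \ K` whose component is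
unbounded. (For bounded `K` there is exactly one unbounded component.) -/
def unboundedComponent (K : Set ℂ) : Set ℂ :=
  {w | w ∈ halfPlane \ K ∧ ¬ Bornology.IsBounded (connectedComponentIn (halfPlane \ K) w)}

/-- `g` is the Loewner map of the set `K`: the conformal transformation of the unbounded component
of `ℍ \ K` onto `ℍ` with the hydrodynamic normalization `g(w) - w → 0` as `w → ∞`. -/
structure IsLoewnerMap (K : Set ℂ) (g : ℂ → ℂ) : Prop where
  differentiableOn : DifferentiableOn ℂ g (unboundedComponent K)
  bijOn : BijOn g (unboundedComponent K) halfPlane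
  hydrodynamic :
    Tendsto (fun w => g w - w) (Bornology.cobounded ℂ ⊓ 𝓟 (unboundedComponent K)) (𝓝 0)

/-- `u` is a boundary value of `g` at `z`: a limit of `g` along some approach to `z` inside the
unbounded component of `ℍ \ K`. For a Loewner chain driven by `U` whose curve has its tip
`z = γ(T) = g_T⁻¹(U_T)`, the value `u = U_T = g_T(z)` is of this kind. -/
def IsBoundaryValue (K : Set ℂ) (g : ℂ → ℂ) (z : ℂ) (u : ℝ) : Prop :=
  MapClusterPt (u : ℂ) (𝓝[unboundedComponent K] z) g

end SLEGreen

/-!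
The map `g` enters only as a conformal map of an open set `H` onto `ℍ`, normalized at infinity,
where `H` is contained in `ℍ` and contains every point of `ℍ` off the neighbourhood `L_{z,ρ}`: such
a point escapes to infinity along a horizontal ray. All estimates are explicit and are deduced from
a minimum principle for the imaginary part of a holomorphic function (`im_nonneg_of_frontier`) and
from the infinitesimal Schwarz–Pick inequality (`norm_deriv_le_of_im_pos`); no boundary regularity
of `g` is needed.

* Applied to `g⁻¹ - id` on `ℍ`, the minimum principle gives `Im g ≤ Im`
  (`IsHydrodynamicMap.im_le`).
* Comparing `g` with `w + R² / w` gives `Im g w ≥ (1 - R² / |w|²) Im w` for `|w| > R`, where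
  `R = 2 |z|` (`IsHydrodynamicMap.le_im_of_norm_gt`). In the disc of radius `2 R`, every point off
  `L_{z,2ρ}` lies well inside a quadrant or a half plane disjoint from `L_{z,ρ}`, on which a harmonic
  polynomial of the form `(α + β x) (y - s)` is a lower barrier for `Im g`
  (`IsHydrodynamicMap.barrier_le_im`). Together, `Im g w ≥ (ρ / 256) Im w` off `L_{z,2ρ}`
  (`IsHydrodynamicMap.mul_im_le_im`).
* The Schwarz–Pick inequality for `g` on a disc of radius comparable to `Im w`, and for `g⁻¹` on the
  disc of radius `Im g w` around `g w`, turns these into two-sided bounds for `|g'|`.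
* The Schwarz–Pick inequality for `id - g` bounds `|(g - id)'|` by `4 R² / |w|²`; integration along
  rays gives `|g w - w| ≤ 2 R` for `|w| ≥ 2 R`, and a connectedness argument then gives
  `|g w| ≤ 4 R` for `|w| ≤ 2 R`. So every boundary value of `g` at `z` has modulus at most `4 R`, and
  `|g w - u|` is at most a constant times `|w|`. Hence `sin arg (g w - u)` is at least a constant
  times `sin arg w`, and the bound for the Green's function follows from the signs of its exponents.
-/

namespace SLEGreen

/-! ### Holomorphic functions and their imaginary parts -/

/-- Minimum principle for the imaginary part of a holomorphic function on an arbitrary open set,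
possibly unbounded, which need not extend continuously to the boundary. The maximum modulus
principle for `exp (i f)` is applied on `{Im f < -ε}`, whose closure is a compact subset of `U`. -/
theorem im_nonneg_of_frontier {U : Set ℂ} (hU : IsOpen U) {f : ℂ → ℂ}
    (hf : DifferentiableOn ℂ f U)
    (hfr : ∀ ζ ∈ frontier U, ∀ ε > 0, ∀ᶠ w in 𝓝[U] ζ, -ε < (f w).im)
    (hinf : ∀ ε > 0, ∀ᶠ w in Bornology.cobounded ℂ ⊓ 𝓟 U, -ε < (f w).im)
    {w : ℂ} (hw : w ∈ U) : 0 ≤ (f w).im := by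
  refine le_of_forall_pos_lt_add fun ε hε => ?_
  by_contra hcon
  set V : Set ℂ := {v | v ∈ U ∧ (f v).im < -(ε / 2)} with hV
  have hcont : ContinuousOn (fun v => (f v).im) U := Complex.continuous_im.comp_continuousOn
    hf.continuousOn
  have hVb : Bornology.IsBounded V := by
    have h := hinf (ε / 2) (by positivity)
    rw [eventually_inf_principal] at h
    rw [← Bornology.isCobounded_compl_iff]
    filter_upwards [h] with v hv hvV
    exact absurd (hv hvV.1) (not_lt.2 hvV.2.le)
  have hVcl : ∀ v ∈ closure V, v ∈ U ∧ (f v).im ≤ -(ε / 2) := by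
    intro v hv
    have hvU : v ∈ U := by
      by_contra hvU
      have hvf : v ∈ frontier U := by
        rw [hU.frontier_eq]
        exact ⟨closure_mono (fun _ h => h.1) hv, hvU⟩
      have h := hfr v hvf (ε / 2) (by positivity)
      rw [eventually_nhdsWithin_iff] at h
      obtain ⟨y, hy, hyV⟩ := mem_closure_iff_nhds.1 hv _ h
      exact absurd (hy hyV.1) (not_lt.2 hyV.2.le)
    refine ⟨hvU, ?_⟩
    by_contra hlt
    have h : ∀ᶠ y in 𝓝 v, -(ε / 2) < (f y).im :=
      (hcont.continuousAt (hU.mem_nhds hvU)).eventually_const_lt (not_le.1 hlt)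
    obtain ⟨y, hy, hyV⟩ := mem_closure_iff_nhds.1 hv _ h
    exact absurd hy (not_lt.2 hyV.2.le)
  have hVo : IsOpen V := hcont.isOpen_inter_preimage hU isOpen_Iio
  have hd : DiffContOnCl ℂ (fun v => Complex.exp (Complex.I * f v)) V := by
    have : DifferentiableOn ℂ (fun v => Complex.exp (Complex.I * f v)) U :=
      (hf.const_mul _).cexp
    exact ⟨this.mono fun v hv => hv.1, this.continuousOn.mono fun v hv => (hVcl v hv).1⟩
  have hnorm : ∀ v, ‖Complex.exp (Complex.I * f v)‖ = Real.exp (-(f v).im) := by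
    intro v; rw [Complex.norm_exp]; simp
  have hle := Complex.norm_le_of_forall_mem_frontier_norm_le hVb hd (C := Real.exp (ε / 2))
    (fun v hv => by
      rw [hnorm, Real.exp_le_exp]
      rw [hVo.frontier_eq] at hv
      have h1 := (hVcl v hv.1).1
      by_contra hlt
      exact hv.2 ⟨h1, by linarith⟩) (subset_closure (show w ∈ V from ⟨hw, by linarith⟩))
  rw [hnorm, Real.exp_le_exp] at hle
  linarith

/-- The infinitesimal Schwarz–Pick inequality for maps from a disc to the upper half plane: the
Schwarz lemma after composition with the Cayley transform. -/
theorem norm_deriv_le_of_im_pos {F : ℂ → ℂ} {w : ℂ} {r : ℝ} (hr : 0 < r)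
    (hF : DifferentiableOn ℂ F (Metric.ball w r)) (him : ∀ v ∈ Metric.ball w r, 0 < (F v).im) :
    ‖deriv F w‖ ≤ 2 * (F w).im / r := by
  have hw : w ∈ Metric.ball w r := Metric.mem_ball_self hr
  have hw0 := him w hw
  have hne : ∀ v ∈ Metric.ball w r, F v - (starRingEnd ℂ) (F w) ≠ 0 := by
    intro v hv h
    have := congrArg Complex.im h
    simp at this
    linarith [him v hv]
  set φ : ℂ → ℂ := fun v => (F v - F w) / (F v - (starRingEnd ℂ) (F w)) with hφ
  have hd : DifferentiableOn ℂ φ (Metric.ball w r) :=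
    (hF.sub_const _).div (hF.sub_const _) hne
  have hφw : φ w = 0 := by simp [hφ]
  have hmaps : MapsTo φ (Metric.ball w r) (Metric.closedBall (φ w) 1) := by
    intro v hv
    rw [hφw, mem_closedBall_zero_iff, hφ]
    simp only [norm_div]
    refine div_le_one_of_le₀ ?_ (norm_nonneg _)
    rw [Complex.norm_def, Complex.norm_def]
    refine Real.sqrt_le_sqrt ?_
    simp only [Complex.normSq_apply, Complex.sub_re, Complex.sub_im, Complex.conj_re,
      Complex.conj_im]
    nlinarith [him v hv, mul_pos (him v hv) hw0]
  have hS := Complex.norm_deriv_le_div_of_mapsTo_ball hd hmaps hr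
  have hFd : HasDerivAt F (deriv F w) w :=
    (hF.differentiableAt (Metric.isOpen_ball.mem_nhds hw)).hasDerivAt
  have hφd : HasDerivAt φ (deriv F w / (F w - (starRingEnd ℂ) (F w))) w := by
    have := (hFd.sub_const (F w)).div (hFd.sub_const ((starRingEnd ℂ) (F w))) (hne w hw)
    convert! this using 1
    have := hne w hw
    field_simp
    ring
  rw [hφd.deriv, norm_div, Complex.sub_conj] at hS
  have h2 : ‖((2 * (F w).im : ℝ) : ℂ) * Complex.I‖ = 2 * (F w).im := by
    rw [norm_mul, Complex.norm_I, mul_one, Complex.norm_real, Real.norm_of_nonneg (by linarith)]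
  rw [h2, div_le_div_iff₀ (by linarith) hr] at hS
  rw [le_div_iff₀ hr]
  linarith

theorem norm_deriv_le_of_im_nonneg {F : ℂ → ℂ} {w : ℂ} {r : ℝ} (hr : 0 < r)
    (hF : DifferentiableOn ℂ F (Metric.ball w r)) (him : ∀ v ∈ Metric.ball w r, 0 ≤ (F v).im) :
    ‖deriv F w‖ ≤ 2 * (F w).im / r := by
  refine le_of_forall_pos_le_add fun ε hε => ?_
  -- `F` is shifted into the open half plane by `i ε r / 2`
  have h := norm_deriv_le_of_im_pos (F := fun v => F v + ((ε * r / 2 : ℝ) : ℂ) * Complex.I) hr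
    (hF.add_const _) (fun v hv => by
      have := him v hv
      have : 0 < ε * r / 2 := by positivity
      simp only [Complex.add_im, Complex.im_ofReal_mul, Complex.I_im]
      linarith)
  rw [deriv_add_const] at h
  refine h.trans_eq ?_
  simp only [Complex.add_im, Complex.im_ofReal_mul, Complex.I_im]
  field_simp

/-! ### Inverses of injective holomorphic functions -/

theorem not_eventually_const_of_injOn {U : Set ℂ} (hU : IsOpen U) {f : ℂ → ℂ}
    (hinj : InjOn f U) {w : ℂ} (hw : w ∈ U) : ¬ ∀ᶠ v in 𝓝 w, f v = f w := by
  intro h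
  have h2 : ∀ᶠ v in 𝓝[≠] w, v = w := by
    filter_upwards [(h.and (hU.mem_nhds hw)).filter_mono nhdsWithin_le_nhds] with v hv
    exact hinj hv.2 hw hv.1
  obtain ⟨v, hv, hv'⟩ := (h2.and self_mem_nhdsWithin).exists
  exact hv' hv

theorem nhds_le_map_of_injOn {U : Set ℂ} (hU : IsOpen U) {f : ℂ → ℂ}
    (hf : DifferentiableOn ℂ f U) (hinj : InjOn f U) {w : ℂ} (hw : w ∈ U) :
    𝓝 (f w) ≤ map f (𝓝 w) :=
  ((hf.analyticAt (hU.mem_nhds hw)).eventually_constant_or_nhds_le_map_nhds).resolve_left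
    (not_eventually_const_of_injOn hU hinj hw)

theorem isOpen_image_of_injOn {U : Set ℂ} (hU : IsOpen U) {f : ℂ → ℂ}
    (hf : DifferentiableOn ℂ f U) (hinj : InjOn f U) {V : Set ℂ} (hVU : V ⊆ U) (hV : IsOpen V) :
    IsOpen (f '' V) := by
  rw [isOpen_iff_mem_nhds]
  rintro _ ⟨w, hw, rfl⟩
  exact nhds_le_map_of_injOn hU hf hinj (hVU hw) (image_mem_map (hV.mem_nhds hw))

theorem continuousAt_invFunOn {U : Set ℂ} (hU : IsOpen U) {f : ℂ → ℂ}
    (hf : DifferentiableOn ℂ f U) (hinj : InjOn f U) {w : ℂ} (hw : w ∈ U) :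
    ContinuousAt (Function.invFunOn f U) (f w) := by
  have hl := hinj.leftInvOn_invFunOn
  intro V hV
  rw [hl hw] at hV
  rw [mem_map]
  have : f '' (V ∩ U) ∈ 𝓝 (f w) :=
    nhds_le_map_of_injOn hU hf hinj hw (image_mem_map (inter_mem hV (hU.mem_nhds hw)))
  filter_upwards [this]
  rintro _ ⟨v, hv, rfl⟩
  change Function.invFunOn f U (f v) ∈ V
  rw [hl hv.2]
  exact hv.1

/-- The inverse of an injective holomorphic function is holomorphic. Critical points are isolated,
so that the inverse is continuous, and holomorphic off a discrete set; such a singularity is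
removable. -/
theorem differentiableAt_invFunOn {U : Set ℂ} (hU : IsOpen U) {f : ℂ → ℂ}
    (hf : DifferentiableOn ℂ f U) (hinj : InjOn f U) {w : ℂ} (hw : w ∈ U) :
    DifferentiableAt ℂ (Function.invFunOn f U) (f w) := by
  have hl := hinj.leftInvOn_invFunOn
  have hc := continuousAt_invFunOn hU hf hinj hw
  have him : f '' U ∈ 𝓝 (f w) :=
    (isOpen_image_of_injOn hU hf hinj Subset.rfl hU).mem_nhds (mem_image_of_mem _ hw)
  have hne : ∀ᶠ v in 𝓝[≠] w, deriv f v ≠ 0 := by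
    refine ((hf.analyticAt (hU.mem_nhds hw)).deriv.eventually_eq_zero_or_eventually_ne_zero
      ).resolve_left fun h => ?_
    refine not_eventually_const_of_injOn hU hinj hw ?_
    obtain ⟨r, hr, hball⟩ := Metric.eventually_nhds_iff_ball.1 (h.and (hU.mem_nhds hw))
    filter_upwards [Metric.ball_mem_nhds w hr] with v hv
    exact Metric.isOpen_ball.is_const_of_deriv_eq_zero (convex_ball w r).isPreconnected
      (hf.mono fun y hy => (hball y hy).2) (fun y hy => (hball y hy).1) hv
      (Metric.mem_ball_self hr)
  refine (Complex.analyticAt_of_differentiable_on_punctured_nhds_of_continuousAt ?_ hc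
    ).differentiableAt
  have ht : Tendsto (Function.invFunOn f U) (𝓝[≠] (f w)) (𝓝[≠] w) := by
    refine tendsto_nhdsWithin_iff.2 ⟨?_, ?_⟩
    · have := hc.tendsto
      rw [hl hw] at this
      exact this.mono_left nhdsWithin_le_nhds
    · filter_upwards [nhdsWithin_le_nhds him, self_mem_nhdsWithin]
      rintro _ ⟨v, hv, rfl⟩ hne
      rw [hl hv]
      rintro rfl
      exact hne rfl
  filter_upwards [ht.eventually hne, nhdsWithin_le_nhds him]
  rintro _ hy ⟨v, hv, rfl⟩
  rw [hl hv] at hy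
  refine (HasDerivAt.of_local_left_inverse (f := f) (f' := deriv f v)
    (continuousAt_invFunOn hU hf hinj hv) ?_ hy ?_).differentiableAt
  · rw [hl hv]
    exact (hf.differentiableAt (hU.mem_nhds hv)).hasDerivAt
  · filter_upwards [(isOpen_image_of_injOn hU hf hinj Subset.rfl hU).mem_nhds
      (mem_image_of_mem _ hv)]
    rintro _ ⟨y, hy, rfl⟩
    rw [hl hy]

theorem deriv_mul_deriv_invFunOn {U : Set ℂ} (hU : IsOpen U) {f : ℂ → ℂ}
    (hf : DifferentiableOn ℂ f U) (hinj : InjOn f U) {w : ℂ} (hw : w ∈ U) :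
    deriv (Function.invFunOn f U) (f w) * deriv f w = 1 := by
  have h1 := (differentiableAt_invFunOn hU hf hinj hw).hasDerivAt.comp w
    (hf.differentiableAt (hU.mem_nhds hw)).hasDerivAt
  have h2 : Function.invFunOn f U ∘ f =ᶠ[𝓝 w] id := by
    filter_upwards [hU.mem_nhds hw] with v hv
    exact hinj.leftInvOn_invFunOn hv
  exact h1.unique ((hasDerivAt_id w).congr_of_eventuallyEq h2)

/-! ### The upper half plane -/

theorem isOpen_halfPlane : IsOpen halfPlane := isOpen_lt continuous_const Complex.continuous_im

/-- The exterior of a disc in the upper half plane is the image of a half-strip under `exp`. -/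
theorem isPreconnected_halfPlane_norm_gt {r : ℝ} (hr : 0 < r) :
    IsPreconnected {w : ℂ | w ∈ halfPlane ∧ r < ‖w‖} := by
  have himg : {w : ℂ | w ∈ halfPlane ∧ r < ‖w‖} =
      Complex.exp '' (Ioi (Real.log r) ×ℂ Ioo 0 Real.pi) := by
    ext w
    constructor
    · rintro ⟨hw, hwr⟩
      have hw0 : w ≠ 0 := by rintro rfl; simp [halfPlane] at hw
      refine ⟨Complex.log w, ⟨?_, ?_⟩, Complex.exp_log hw0⟩
      · simpa [Complex.log_re] using Real.log_lt_log hr hwr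
      · have h1 : w.arg ≠ 0 := fun h => by
          have := (Complex.arg_eq_zero_iff.1 h).2
          exact absurd this (ne_of_gt hw)
        have h2 : 0 ≤ w.arg := Complex.arg_nonneg_iff.2 (le_of_lt hw)
        have h3 : w.arg ≠ Real.pi := fun h => by
          have := (Complex.arg_eq_pi_iff.1 h).2
          exact absurd this (ne_of_gt hw)
        simp only [mem_preimage, Complex.log_im]
        exact ⟨lt_of_le_of_ne h2 h1.symm, lt_of_le_of_ne (Complex.arg_le_pi w) h3⟩
    · rintro ⟨v, ⟨hv1, hv2⟩, rfl⟩
      simp only [mem_preimage, mem_Ioi, mem_Ioo] at hv1 hv2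
      refine ⟨?_, ?_⟩
      · simp only [halfPlane, mem_ofPred_eq, Complex.exp_im]
        exact mul_pos (Real.exp_pos _) (Real.sin_pos_of_pos_of_lt_pi hv2.1 hv2.2)
      · rw [Complex.norm_exp]
        exact (Real.log_lt_iff_lt_exp hr).1 hv1
  rw [himg]
  refine (Convex.isPreconnected ?_).image _ Complex.continuous_exp.continuousOn
  exact ((convex_Ioi _).linear_preimage Complex.reLm).inter
    ((convex_Ioo _ _).linear_preimage Complex.imLm)

/-! ### Hydrodynamically normalized maps -/

/-- `g` is a conformal map of the open set `H ⊆ ℍ` onto `ℍ` with `g w - w → 0` at infinity, and `H`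
contains all points of `ℍ` of modulus larger than `R`. -/
structure IsHydrodynamicMap (H : Set ℂ) (R : ℝ) (g : ℂ → ℂ) : Prop where
  radius_pos : 0 < R
  isOpen : IsOpen H
  subset : H ⊆ halfPlane
  mem_of_norm_gt : ∀ w ∈ halfPlane, R < ‖w‖ → w ∈ H
  differentiableOn : DifferentiableOn ℂ g H
  bijOn : BijOn g H halfPlane
  hydrodynamic : Tendsto (fun w => g w - w) (Bornology.cobounded ℂ ⊓ 𝓟 H) (𝓝 0)

namespace IsHydrodynamicMap

variable {H : Set ℂ} {R : ℝ} {g : ℂ → ℂ}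

theorem im_pos (hg : IsHydrodynamicMap H R g) {w : ℂ} (hw : w ∈ H) : 0 < (g w).im :=
  hg.bijOn.mapsTo hw

/-- Comparison of `Im g` with the imaginary part of the Joukowsky map `w + R² / w`, which is
real on the boundary of the part of `ℍ` outside the disc of radius `R`. -/
theorem le_im_of_norm_gt (hg : IsHydrodynamicMap H R g) {w : ℂ} (hw : w ∈ halfPlane)
    (hR : R < ‖w‖) : w.im * (1 - R ^ 2 / ‖w‖ ^ 2) ≤ (g w).im := by
  have hRpos := hg.radius_pos
  set U : Set ℂ := {w | w ∈ halfPlane ∧ R < ‖w‖} with hU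
  have hUo : IsOpen U := isOpen_halfPlane.inter (isOpen_lt continuous_const continuous_norm)
  have hUH : U ⊆ H := fun v hv => hg.mem_of_norm_gt v hv.1 hv.2
  have hne : ∀ v : ℂ, R ≤ ‖v‖ → v ≠ 0 := fun v hv h => by
    rw [h, norm_zero] at hv; linarith
  have him : ∀ v : ℂ, R ≤ ‖v‖ →
      (v + (R : ℂ) ^ 2 / v).im = v.im * (1 - R ^ 2 / ‖v‖ ^ 2) := by
    intro v hv
    have h0 : Complex.normSq v ≠ 0 := by simpa using hne v hv
    rw [← Complex.ofReal_pow, Complex.add_im, Complex.div_im, ← Complex.normSq_eq_norm_sq]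
    simp only [Complex.ofReal_im, Complex.ofReal_re]
    field_simp
    ring
  have key := im_nonneg_of_frontier hUo (f := fun v => g v - (v + (R : ℂ) ^ 2 / v))
    ((hg.differentiableOn.mono hUH).sub (differentiableOn_id.add
      ((differentiableOn_const _).div differentiableOn_id fun v hv => hne v hv.2.le)))
    ?_ ?_ (show w ∈ U from ⟨hw, hR⟩)
  · rw [Complex.sub_im, him w hR.le] at key
    linarith
  · intro ζ hζ ε hε
    rw [hUo.frontier_eq] at hζ
    have hcl : 0 ≤ ζ.im ∧ R ≤ ‖ζ‖ := by
      have : closure U ⊆ {v : ℂ | 0 ≤ v.im ∧ R ≤ ‖v‖} :=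
        closure_minimal (fun v hv => ⟨le_of_lt hv.1, hv.2.le⟩)
          ((isClosed_le continuous_const Complex.continuous_im).inter
            (isClosed_le continuous_const continuous_norm))
      exact this hζ.1
    have hzero : (ζ + (R : ℂ) ^ 2 / ζ).im = 0 := by
      rw [him ζ hcl.2]
      by_cases h0 : 0 < ζ.im
      · have : ‖ζ‖ = R := le_antisymm (not_lt.1 fun h => hζ.2 ⟨h0, h⟩) hcl.2
        rw [this, div_self (by positivity)]
        simp
      · rw [le_antisymm (not_lt.1 h0) hcl.1, zero_mul]
    have hc : ContinuousAt (fun v : ℂ => (v + (R : ℂ) ^ 2 / v).im) ζ :=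
      Complex.continuous_im.continuousAt.comp
        (continuousAt_id.add (continuousAt_const.div continuousAt_id (hne ζ hcl.2)))
    have he : ∀ᶠ v in 𝓝[U] ζ, (v + (R : ℂ) ^ 2 / v).im < ε :=
      (hc.eventually_lt_const (hzero.trans_lt hε)).filter_mono nhdsWithin_le_nhds
    filter_upwards [he, self_mem_nhdsWithin] with v hv hvU
    rw [Complex.sub_im]
    linarith [hg.im_pos (hUH hvU)]
  · intro ε hε
    have h1 : Tendsto (fun v => g v - v) (Bornology.cobounded ℂ ⊓ 𝓟 U) (𝓝 0) :=
      hg.hydrodynamic.mono_left (inf_le_inf_left _ (principal_mono.2 hUH))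
    have h2 : Tendsto (fun v : ℂ => (R : ℂ) ^ 2 / v) (Bornology.cobounded ℂ ⊓ 𝓟 U) (𝓝 0) := by
      have : Tendsto (fun v : ℂ => (R : ℂ) ^ 2 * v⁻¹) (Bornology.cobounded ℂ)
          (𝓝 ((R : ℂ) ^ 2 * 0)) := tendsto_inv₀_cobounded.const_mul _
      rw [mul_zero] at this
      exact this.mono_left inf_le_left
    have h3 := (Complex.continuous_im.tendsto _).comp (h1.sub h2)
    filter_upwards [h3.eventually_const_lt (show -ε < ((0 : ℂ) - 0).im by simpa using hε)] with v hv
    simpa [sub_sub] using hv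

/-- Points of bounded modulus have images of bounded modulus: the image under `g` of the exterior of
a disc covers the exterior of a larger disc, by connectedness of the latter. -/
theorem norm_le_of_norm_sub_le (hg : IsHydrodynamicMap H R g) {S M : ℝ} (hS : R < S) (hM : 0 ≤ M)
    (h : ∀ w ∈ H, S ≤ ‖w‖ → ‖g w - w‖ ≤ M) {w : ℂ} (hw : w ∈ H) (hwS : ‖w‖ ≤ S) :
    ‖g w‖ ≤ S + M := by
  have hRpos := hg.radius_pos
  by_contra hcon
  rw [not_le] at hcon
  have hinj := hg.bijOn.injOn
  have hbd : ∀ v ∈ H, ‖v‖ = S → ‖g v‖ ≤ S + M := by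
    intro v hv hvS
    have := norm_le_insert' (g v) v
    linarith [h v hv hvS.ge]
  have ho1 : IsOpen (g '' (H ∩ {v | ‖v‖ < S})) :=
    isOpen_image_of_injOn hg.isOpen hg.differentiableOn hinj inter_subset_left
      (hg.isOpen.inter (isOpen_lt continuous_norm continuous_const))
  have ho2 : IsOpen (g '' (H ∩ {v | S < ‖v‖})) :=
    isOpen_image_of_injOn hg.isOpen hg.differentiableOn hinj inter_subset_left
      (hg.isOpen.inter (isOpen_lt continuous_const continuous_norm))
  have hsub := (isPreconnected_halfPlane_norm_gt (show 0 < S + M by linarith)) _ _ ho1 ho2 ?_ ?_ ?_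
  · obtain ⟨_, _, ⟨a, ha, rfl⟩, ⟨b, hb, hab⟩⟩ := hsub
    rw [hinj hb.1 ha.1 hab] at hb
    exact lt_asymm (show ‖a‖ < S from ha.2) hb.2
  · rintro ζ ⟨hζ, hζn⟩
    obtain ⟨v, hv, rfl⟩ := hg.bijOn.surjOn hζ
    rcases lt_trichotomy ‖v‖ S with h1 | h1 | h1
    · exact Or.inl ⟨v, ⟨hv, h1⟩, rfl⟩
    · exact absurd (hbd v hv h1) (not_le.2 hζn)
    · exact Or.inr ⟨v, ⟨hv, h1⟩, rfl⟩
  · refine ⟨g w, ⟨hg.im_pos hw, hcon⟩, w, ⟨hw, lt_of_le_of_ne hwS fun he => ?_⟩, rfl⟩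
    exact absurd (hbd w hw he) (not_le.2 hcon)
  · set t : ℝ := S + 2 * M + 1
    have ht : 0 < t := by simp only [t]; linarith
    have hnorm : ‖(t : ℂ) * Complex.I‖ = t := by
      rw [norm_mul, Complex.norm_I, mul_one, Complex.norm_real, Real.norm_of_nonneg ht.le]
    have htH : (t : ℂ) * Complex.I ∈ H := by
      refine hg.mem_of_norm_gt _ ?_ (by rw [hnorm]; simp only [t]; linarith)
      simpa [halfPlane] using ht
    refine ⟨g (t * Complex.I), ⟨hg.im_pos htH, ?_⟩, t * Complex.I, ⟨htH, ?_⟩, rfl⟩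
    · have h1 := h _ htH (by rw [hnorm]; simp only [t]; linarith)
      have h2 := norm_le_insert (g (t * Complex.I)) (t * Complex.I)
      rw [hnorm] at h2
      simp only [t] at h1 h2 ⊢
      linarith
    · change S < ‖(t : ℂ) * Complex.I‖
      rw [hnorm]; simp only [t]; linarith

/-- `g` decreases imaginary parts: `Im g⁻¹(ζ) - Im ζ` is nonnegative on the real line and vanishes
at infinity. -/
theorem im_le (hg : IsHydrodynamicMap H R g) {w : ℂ} (hw : w ∈ H) : (g w).im ≤ w.im := by
  have hinj := hg.bijOn.injOn
  set h := Function.invFunOn g H with hh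
  have hl : ∀ v ∈ H, h (g v) = v := fun v hv => hinj.leftInvOn_invFunOn hv
  have key := im_nonneg_of_frontier isOpen_halfPlane (f := fun ζ => h ζ - ζ) ?_ ?_ ?_ (hg.im_pos hw)
  · simp only [hl w hw, Complex.sub_im] at key
    linarith
  · intro ζ hζ
    obtain ⟨v, hv, rfl⟩ := hg.bijOn.surjOn hζ
    exact ((differentiableAt_invFunOn hg.isOpen hg.differentiableOn hinj hv).sub
      differentiableAt_id).differentiableWithinAt
  · intro ζ hζ ε hε
    rw [isOpen_halfPlane.frontier_eq] at hζ
    have him : ζ.im ≤ 0 := not_lt.1 hζ.2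
    have he : ∀ᶠ v in 𝓝[halfPlane] ζ, v.im < ε :=
      (Complex.continuous_im.continuousAt.eventually_lt_const (by linarith)).filter_mono
        nhdsWithin_le_nhds
    filter_upwards [he, self_mem_nhdsWithin] with v hv hvU
    obtain ⟨y, hy, rfl⟩ := hg.bijOn.surjOn hvU
    have : 0 < y.im := hg.subset hy
    rw [hl y hy, Complex.sub_im]
    linarith
  · intro ε hε
    obtain ⟨S, hS⟩ : ∃ S : ℝ, ∀ v ∈ H, S ≤ ‖v‖ → ‖g v - v‖ < min ε 1 := by
      have h1 := hg.hydrodynamic (Metric.ball_mem_nhds 0 (show 0 < min ε 1 by positivity))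
      have h1' : ∀ᶠ v in Bornology.cobounded ℂ ⊓ 𝓟 H, ‖g v - v‖ < min ε 1 := by
        filter_upwards [h1] with v hv using mem_ball_zero_iff.1 hv
      rw [eventually_inf_principal] at h1'
      obtain ⟨S, -, hS⟩ := (hasBasis_cobounded_norm (E := ℂ)).eventually_iff.1 h1'
      exact ⟨S, fun v hv hvS => hS hvS hv⟩
    set S' := max S (R + 1)
    have hb : ∀ v ∈ H, ‖v‖ ≤ S' → ‖g v‖ ≤ S' + 1 := fun v hv hvS =>
      hg.norm_le_of_norm_sub_le (lt_of_lt_of_le (by linarith) (le_max_right S (R + 1)))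
        zero_le_one (fun y hy hyS => ((hS y hy ((le_max_left _ _).trans hyS)).le).trans
          (min_le_right _ _)) hv hvS
    rw [eventually_inf_principal]
    refine (hasBasis_cobounded_norm (E := ℂ)).eventually_iff.2 ⟨S' + 2, trivial, fun ζ hζ hζU => ?_⟩
    obtain ⟨v, hv, rfl⟩ := hg.bijOn.surjOn hζU
    have hvS : S ≤ ‖v‖ := by
      by_contra hlt
      have := hb v hv ((not_le.1 hlt).le.trans (le_max_left _ _))
      have h2 : S' + 2 ≤ ‖g v‖ := hζ
      linarith
    have h3 := (hS v hv hvS).trans_le (min_le_left _ _)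
    have h4 := Complex.abs_im_le_norm (g v - v)
    rw [hl v hv, Complex.sub_im]
    rw [Complex.sub_im] at h4
    linarith [(abs_le.1 (h4.trans h3.le)).2, (abs_lt.1 (h4.trans_lt h3)).2]

theorem norm_deriv_sub_le (hg : IsHydrodynamicMap H R g) {w : ℂ} (hw : w ∈ halfPlane)
    (hwR : 2 * R ≤ ‖w‖) : ‖deriv (fun v => g v - v) w‖ ≤ 4 * R ^ 2 / ‖w‖ ^ 2 := by
  have hRpos := hg.radius_pos
  have hwim : 0 < w.im := hw
  have hball : ∀ v ∈ Metric.ball w (w.im / 2), v ∈ H := by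
    intro v hv
    rw [mem_ball_iff_norm] at hv
    have h1 := abs_le.1 (Complex.abs_im_le_norm (v - w))
    have h2 := norm_le_insert v w
    have h3 := Complex.abs_im_le_norm w
    rw [abs_of_pos hwim] at h3
    rw [Complex.sub_im] at h1
    refine hg.mem_of_norm_gt v ?_ (by linarith)
    change 0 < v.im
    linarith
  -- the Schwarz–Pick inequality on the disc of radius `Im w / 2`
  have h := norm_deriv_le_of_im_nonneg (F := fun v => v - g v) (half_pos hwim)
    (differentiableOn_id.sub (hg.differentiableOn.mono hball)) (fun v hv => by
      rw [Complex.sub_im]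
      linarith [hg.im_le (hball v hv)])
  have he : (fun v => g v - v) = fun v => -(v - g v) := by ext v; ring
  rw [he, deriv.fun_neg, norm_neg]
  refine h.trans ?_
  have h1 := hg.le_im_of_norm_gt hw (by linarith)
  have hn : 0 < ‖w‖ := by linarith
  calc 2 * (w - g w).im / (w.im / 2) ≤ 2 * (w.im * (R ^ 2 / ‖w‖ ^ 2)) / (w.im / 2) := by
        rw [Complex.sub_im]
        gcongr
        linarith
    _ = 4 * R ^ 2 / ‖w‖ ^ 2 := by field_simp; ring

/-- The derivative bound is integrated along the ray from `w` to infinity. -/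
theorem norm_sub_le (hg : IsHydrodynamicMap H R g) {w : ℂ} (hw : w ∈ halfPlane)
    (hwR : 2 * R ≤ ‖w‖) : ‖g w - w‖ ≤ 2 * R := by
  have hRpos := hg.radius_pos
  have hwim : 0 < w.im := hw
  have hn : 0 < ‖w‖ := by linarith
  set f : ℂ → ℂ := fun v => g v - v with hf
  have hnorm : ∀ t : ℝ, 1 ≤ t → ‖(t : ℂ) * w‖ = t * ‖w‖ := fun t ht => by
    rw [norm_mul, Complex.norm_real, Real.norm_of_nonneg (by linarith)]
  have hray : ∀ t : ℝ, 1 ≤ t → (t : ℂ) * w ∈ halfPlane ∧ 2 * R ≤ ‖(t : ℂ) * w‖ := by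
    intro t ht
    refine ⟨?_, ?_⟩
    · simp only [halfPlane, mem_ofPred_eq, Complex.im_ofReal_mul]
      positivity
    · rw [hnorm t ht]
      nlinarith
  have hrayH : ∀ t : ℝ, 1 ≤ t → (t : ℂ) * w ∈ H := fun t ht =>
    hg.mem_of_norm_gt _ (hray t ht).1 (by linarith [(hray t ht).2])
  have hder : ∀ t : ℝ, 1 ≤ t →
      HasDerivAt (fun s : ℝ => f ((s : ℂ) * w)) (deriv f ((t : ℂ) * w) * w) t := by
    intro t ht
    have h1 : HasDerivAt f (deriv f ((t : ℂ) * w)) ((t : ℂ) * w) :=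
      ((hg.differentiableOn.differentiableAt (hg.isOpen.mem_nhds (hrayH t ht))).sub
        differentiableAt_id).hasDerivAt
    have h2 : HasDerivAt (fun s : ℂ => s * w) w (t : ℂ) := by
      simpa using (hasDerivAt_id (t : ℂ)).mul_const w
    exact (h1.comp (t : ℂ) h2).comp_ofReal
  have hbound : ∀ b : ℝ, 1 ≤ b → ‖f ((b : ℂ) * w) - f w‖ ≤ 4 * R ^ 2 / ‖w‖ := by
    intro b hb
    have h := image_norm_le_of_norm_deriv_right_le_deriv_boundary' (a := 1) (b := b)
      (f := fun s : ℝ => f ((s : ℂ) * w) - f w) (f' := fun s : ℝ => deriv f ((s : ℂ) * w) * w)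
      (B := fun s => 4 * R ^ 2 / ‖w‖ * (1 - s⁻¹)) (B' := fun s => 4 * R ^ 2 / ‖w‖ * (s ^ 2)⁻¹)
      (fun s hs => ((hder s hs.1).sub_const _).continuousAt.continuousWithinAt)
      (fun s hs => ((hder s hs.1).sub_const _).hasDerivWithinAt)
      (by simp)
      (fun s hs => ((continuousAt_const.sub (continuousAt_inv₀
        (by linarith [hs.1]))).const_mul _).continuousWithinAt)
      (fun s hs => by
        have := ((hasDerivAt_inv (show s ≠ 0 by linarith [hs.1])).const_sub 1).const_mul
          (4 * R ^ 2 / ‖w‖)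
        simpa using this.hasDerivWithinAt)
      (fun s hs => by
        have h1 := hg.norm_deriv_sub_le (hray s hs.1).1 (hray s hs.1).2
        rw [hnorm s hs.1] at h1
        rw [norm_mul]
        have hs0 : 0 < s := by linarith [hs.1]
        calc ‖deriv f ((s : ℂ) * w)‖ * ‖w‖ ≤ 4 * R ^ 2 / (s * ‖w‖) ^ 2 * ‖w‖ := by gcongr
          _ = _ := by field_simp)
      (right_mem_Icc.2 hb)
    refine h.trans ?_
    have : 0 ≤ b⁻¹ := by positivity
    have h0 : 0 ≤ 4 * R ^ 2 / ‖w‖ := by positivity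
    nlinarith
  have hlim : Tendsto (fun b : ℝ => ‖f ((b : ℂ) * w) - f w‖) atTop (𝓝 ‖0 - f w‖) := by
    refine ((hg.hydrodynamic.comp (tendsto_inf.2 ⟨?_, ?_⟩)).sub_const _).norm
    · refine tendsto_norm_atTop_iff_cobounded.1 ?_
      refine (tendsto_id.atTop_mul_const hn).congr' ?_
      filter_upwards [eventually_ge_atTop 1] with t ht
      exact (hnorm t ht).symm
    · refine tendsto_principal.2 ?_
      filter_upwards [eventually_ge_atTop 1] with t ht using hrayH t ht
  have h := le_of_tendsto hlim ((eventually_ge_atTop 1).mono hbound)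
  rw [zero_sub, norm_neg] at h
  refine h.trans ?_
  rw [div_le_iff₀ hn]
  nlinarith

theorem norm_le_four_mul (hg : IsHydrodynamicMap H R g) {w : ℂ} (hw : w ∈ H) (hwR : ‖w‖ ≤ 2 * R) :
    ‖g w‖ ≤ 4 * R := by
  have hRpos := hg.radius_pos
  have := hg.norm_le_of_norm_sub_le (S := 2 * R) (M := 2 * R) (by linarith) (by linarith)
    (fun v hv hvR => hg.norm_sub_le (hg.subset hv) hvR) hw hwR
  linarith

theorem norm_le_add (hg : IsHydrodynamicMap H R g) {w : ℂ} (hw : w ∈ H) :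
    ‖g w‖ ≤ ‖w‖ + 4 * R := by
  have hRpos := hg.radius_pos
  rcases le_total ‖w‖ (2 * R) with h | h
  · linarith [hg.norm_le_four_mul hw h, norm_nonneg w]
  · have h1 := hg.norm_sub_le (hg.subset hw) h
    have h2 := norm_le_insert' (g w) w
    linarith

/-- Boundary values at points of the disc of radius `2 R` are bounded. -/
theorem norm_le_of_mapClusterPt (hg : IsHydrodynamicMap H R g) {z u : ℂ} (hz : ‖z‖ < 2 * R)
    (hu : MapClusterPt u (𝓝[H] z) g) : ‖u‖ ≤ 4 * R := by
  have h : ∀ᶠ w in 𝓝[H] z, g w ∈ Metric.closedBall (0 : ℂ) (4 * R) := by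
    filter_upwards [self_mem_nhdsWithin, nhdsWithin_le_nhds
      ((isOpen_lt continuous_norm continuous_const).mem_nhds hz)] with w hw hwR
    rw [mem_closedBall_zero_iff]
    exact hg.norm_le_four_mul hw (le_of_lt hwR)
  have := isClosed_iff_clusterPt.1 (Metric.isClosed_closedBall (x := (0 : ℂ)) (ε := 4 * R)) u
    (ClusterPt.mono hu (tendsto_principal.2 h))
  rwa [mem_closedBall_zero_iff] at this

theorem norm_deriv_le (hg : IsHydrodynamicMap H R g) {w : ℂ} {r : ℝ} (hr : 0 < r)
    (hball : Metric.ball w r ⊆ H) : ‖deriv g w‖ ≤ 2 * w.im / r := by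
  refine (norm_deriv_le_of_im_pos hr (hg.differentiableOn.mono hball)
    fun v hv => hg.im_pos (hball hv)).trans ?_
  gcongr
  exact hg.im_le (hball (Metric.mem_ball_self hr))

/-- The Schwarz–Pick inequality for the inverse map. -/
theorem le_norm_deriv (hg : IsHydrodynamicMap H R g) {w : ℂ} (hw : w ∈ H) :
    (g w).im / (2 * w.im) ≤ ‖deriv g w‖ := by
  have hinj := hg.bijOn.injOn
  have hpos := hg.im_pos hw
  have hwim : 0 < w.im := hg.subset hw
  have hl : ∀ v ∈ H, Function.invFunOn g H (g v) = v := fun v hv => hinj.leftInvOn_invFunOn hv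
  have hball : ∀ ζ ∈ Metric.ball (g w) (g w).im, ζ ∈ halfPlane := by
    intro ζ hζ
    rw [mem_ball_iff_norm] at hζ
    have h1 := abs_lt.1 ((Complex.abs_im_le_norm (ζ - g w)).trans_lt hζ)
    rw [Complex.sub_im] at h1
    change 0 < ζ.im
    linarith
  have h := norm_deriv_le_of_im_pos (F := Function.invFunOn g H) hpos
    (fun ζ hζ => by
      obtain ⟨v, hv, rfl⟩ := hg.bijOn.surjOn (hball ζ hζ)
      exact (differentiableAt_invFunOn hg.isOpen hg.differentiableOn hinj
        hv).differentiableWithinAt)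
    (fun ζ hζ => by
      obtain ⟨v, hv, rfl⟩ := hg.bijOn.surjOn (hball ζ hζ)
      rw [hl v hv]
      exact hg.subset hv)
  have h1 := congrArg norm (deriv_mul_deriv_invFunOn hg.isOpen hg.differentiableOn hinj hw)
  rw [norm_mul, norm_one] at h1
  rw [hl w hw, le_div_iff₀ hpos] at h
  rw [div_le_iff₀ (by positivity)]
  have h2 := norm_nonneg (deriv g w)
  calc (g w).im = ‖deriv (Function.invFunOn g H) (g w)‖ * (g w).im * ‖deriv g w‖ := by
        rw [mul_right_comm, h1, one_mul]
    _ ≤ 2 * w.im * ‖deriv g w‖ := by gcongr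
    _ = _ := mul_comm _ _

/-- Lower bound for `Im g` in the part of a quadrant (or of a half plane, if `β = 0`) that lies in
the disc of radius `2 R`. The barrier `(α + β x) (y - s)` is harmonic and vanishes on the sides of
the quadrant; on the arc `|w| = 2 R` it is controlled by `le_im_of_norm_gt`. -/
theorem barrier_le_im (hg : IsHydrodynamicMap H R g) {α β s M : ℝ} (hs : 0 ≤ s) (hM : 0 < M)
    (hαβ : ∀ v : ℂ, ‖v‖ ≤ 2 * R → α + β * v.re ≤ M)
    (hH : ∀ v : ℂ, 0 < α + β * v.re → s < v.im → ‖v‖ < 2 * R → v ∈ H)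
    {w : ℂ} (h1 : 0 < α + β * w.re) (h2 : s < w.im) (h3 : ‖w‖ < 2 * R) :
    3 / (4 * M) * ((α + β * w.re) * (w.im - s)) ≤ (g w).im := by
  have hRpos := hg.radius_pos
  set U : Set ℂ := {v | 0 < α + β * v.re ∧ s < v.im ∧ ‖v‖ < 2 * R} with hU
  have hre : Continuous fun v : ℂ => α + β * v.re := by fun_prop
  have hUo : IsOpen U := (isOpen_lt continuous_const hre).inter
    ((isOpen_lt continuous_const Complex.continuous_im).inter
      (isOpen_lt continuous_norm continuous_const))
  have hUH : U ⊆ H := fun v hv => hH v hv.1 hv.2.1 hv.2.2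
  set k : ℝ := 3 / (4 * M) with hk
  have hkpos : 0 < k := by positivity
  have hkM : k * M = 3 / 4 := by rw [hk]; field_simp
  set F : ℂ → ℂ := fun v => (k : ℂ) * ((α : ℂ) * v + (β : ℂ) * (v * v / ((2 : ℝ) : ℂ))
    - ((s * β : ℝ) : ℂ) * (Complex.I * v) - ((s * α : ℝ) : ℂ) * Complex.I) with hF
  have hFim : ∀ v, (F v).im = k * ((α + β * v.re) * (v.im - s)) := by
    intro v
    simp only [hF, Complex.sub_im, Complex.add_im, Complex.div_ofReal_im, Complex.mul_im,
      Complex.I_re, Complex.I_im, Complex.ofReal_re, Complex.ofReal_im]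
    ring
  have hBc : Continuous fun v : ℂ => k * ((α + β * v.re) * (v.im - s)) := by fun_prop
  have key := im_nonneg_of_frontier hUo (f := fun v => g v - F v)
    ((hg.differentiableOn.mono hUH).sub (by fun_prop)) ?_ ?_ (show w ∈ U from ⟨h1, h2, h3⟩)
  · rw [Complex.sub_im, hFim] at key
    linarith
  · intro ζ hζ ε hε
    rw [hUo.frontier_eq] at hζ
    have hcl : 0 ≤ α + β * ζ.re ∧ s ≤ ζ.im ∧ ‖ζ‖ ≤ 2 * R := by
      have : closure U ⊆ {v : ℂ | 0 ≤ α + β * v.re ∧ s ≤ v.im ∧ ‖v‖ ≤ 2 * R} :=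
        closure_minimal (fun v hv => ⟨hv.1.le, hv.2.1.le, hv.2.2.le⟩)
          ((isClosed_le continuous_const hre).inter
            ((isClosed_le continuous_const Complex.continuous_im).inter
              (isClosed_le continuous_norm continuous_const)))
      exact this hζ.1
    by_cases hB : (α + β * ζ.re) * (ζ.im - s) = 0
    · have he : ∀ᶠ v in 𝓝[U] ζ, k * ((α + β * v.re) * (v.im - s)) < ε :=
        (hBc.continuousAt.eventually_lt_const (show k * _ < ε by
          rw [hB, mul_zero]; exact hε)).filter_mono nhdsWithin_le_nhds
      filter_upwards [he, self_mem_nhdsWithin] with v hv hvU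
      rw [Complex.sub_im, hFim]
      linarith [hg.im_pos (hUH hvU)]
    · have ha : 0 < α + β * ζ.re := lt_of_le_of_ne hcl.1 fun h => hB (by rw [← h, zero_mul])
      have hb : 0 < ζ.im - s := lt_of_le_of_ne (by linarith [hcl.2.1]) fun h => hB (by
        rw [← h, mul_zero])
      have hnorm : ‖ζ‖ = 2 * R := le_antisymm hcl.2.2 (not_lt.1 fun h =>
        hζ.2 ⟨ha, by linarith, h⟩)
      have hc : ContinuousAt (fun v : ℂ => v.im * (1 - R ^ 2 / ‖v‖ ^ 2)
          - k * ((α + β * v.re) * (v.im - s))) ζ := by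
        refine ContinuousAt.sub (Complex.continuous_im.continuousAt.mul (continuousAt_const.sub
          (continuousAt_const.div (continuous_norm.pow 2).continuousAt ?_))) hBc.continuousAt
        rw [hnorm]
        positivity
      have hval : 0 ≤ ζ.im * (1 - R ^ 2 / ‖ζ‖ ^ 2) - k * ((α + β * ζ.re) * (ζ.im - s)) := by
        have e1 : 1 - R ^ 2 / ‖ζ‖ ^ 2 = 3 / 4 := by rw [hnorm]; field_simp; norm_num
        have e2 : k * ((α + β * ζ.re) * (ζ.im - s)) ≤ 3 / 4 * ζ.im := by
          calc k * ((α + β * ζ.re) * (ζ.im - s)) ≤ k * (M * ζ.im) := by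
                gcongr
                · exact hαβ ζ hcl.2.2
                · linarith
            _ = 3 / 4 * ζ.im := by rw [← mul_assoc, hkM]
        rw [e1]
        linarith
      have he := hc.eventually_const_lt (show -ε < _ by linarith)
      have hR' : ∀ᶠ v in 𝓝 ζ, R < ‖v‖ :=
        continuous_norm.continuousAt.eventually_const_lt (show R < ‖ζ‖ by rw [hnorm]; linarith)
      filter_upwards [nhdsWithin_le_nhds he, nhdsWithin_le_nhds hR', self_mem_nhdsWithin]
        with v hv hvR hvU
      rw [Complex.sub_im, hFim]
      linarith [hg.le_im_of_norm_gt (hg.subset (hUH hvU)) hvR]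
  · intro ε hε
    have hUb : Bornology.IsBounded U :=
      Metric.isBounded_ball.subset fun v hv => mem_ball_zero_iff.2 hv.2.2
    rw [eventually_inf_principal]
    filter_upwards [Bornology.isCobounded_compl_iff.2 hUb] with v hv hvU
    exact absurd hvU hv

end IsHydrodynamicMap

/-! ### Neighbourhoods of the L-shape -/

theorem mem_lShape_iff {z l : ℂ} (hz : 0 ≤ z.im) :
    l ∈ lShape z ↔ (l.im = 0 ∧ l.re ∈ uIcc 0 z.re) ∨ (l.re = z.re ∧ l.im ∈ Icc 0 z.im) := by
  have h1 : segment ℝ (0 : ℂ) (z.re : ℂ) = {l | l.im = 0 ∧ l.re ∈ uIcc 0 z.re} := by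
    have h := image_segment ℝ Complex.ofRealLI.toLinearMap.toAffineMap 0 z.re
    have e1 : Complex.ofRealLI.toLinearMap.toAffineMap 0 = (0 : ℂ) := by simp
    have e2 : Complex.ofRealLI.toLinearMap.toAffineMap z.re = (z.re : ℂ) := by simp
    rw [segment_eq_uIcc, e1, e2] at h
    rw [← h]
    ext l
    constructor
    · rintro ⟨t, ht, rfl⟩
      simpa using ht
    · rintro ⟨hl, hl'⟩
      exact ⟨l.re, hl', by apply Complex.ext <;> simp [hl]⟩
  have h2 : segment ℝ (z.re : ℂ) z = {l | l.re = z.re ∧ l.im ∈ Icc 0 z.im} := by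
    have h := image_segment ℝ ((LinearMap.toSpanSingleton ℝ ℂ Complex.I).toAffineMap +
      AffineMap.const ℝ ℝ (z.re : ℂ)) 0 z.im
    have e1 : ((LinearMap.toSpanSingleton ℝ ℂ Complex.I).toAffineMap +
      AffineMap.const ℝ ℝ (z.re : ℂ)) 0 = (z.re : ℂ) := by simp
    have e2 : ((LinearMap.toSpanSingleton ℝ ℂ Complex.I).toAffineMap +
      AffineMap.const ℝ ℝ (z.re : ℂ)) z.im = z := by apply Complex.ext <;> simp
    rw [segment_eq_Icc hz, e1, e2] at h
    rw [← h]
    ext l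
    constructor
    · rintro ⟨t, ht, rfl⟩
      simpa using ht
    · rintro ⟨hl, hl'⟩
      exact ⟨l.im, hl', by apply Complex.ext <;> simp [hl]⟩
  rw [lShape, h1, h2]
  rfl

theorem isCompact_lShape (z : ℂ) : IsCompact (lShape z) := by
  have h : ∀ a b : ℂ, IsCompact (segment ℝ a b) := fun a b => by
    rw [segment_eq_image_lineMap]
    exact isCompact_Icc.image AffineMap.lineMap_continuous
  exact (h _ _).union (h _ _)

theorem zero_mem_lShape (z : ℂ) : (0 : ℂ) ∈ lShape z := Or.inl (left_mem_segment ℝ _ _)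

theorem norm_le_of_mem_lShape {z l : ℂ} (hl : l ∈ lShape z) : ‖l‖ ≤ ‖z‖ := by
  have h0 : (0 : ℂ) ∈ Metric.closedBall (0 : ℂ) ‖z‖ := by simp
  have h1 : (z.re : ℂ) ∈ Metric.closedBall (0 : ℂ) ‖z‖ := by
    simpa using Complex.abs_re_le_norm z
  have h2 : z ∈ Metric.closedBall (0 : ℂ) ‖z‖ := by simp
  have hc := convex_closedBall (0 : ℂ) ‖z‖
  rw [← mem_closedBall_zero_iff]
  exact hl.elim (fun h => hc.segment_subset h0 h1 h) (fun h => hc.segment_subset h1 h2 h)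

theorem mem_lNhd_iff {z w : ℂ} {ρ : ℝ} (hw : 0 ≤ w.im) :
    w ∈ lNhd z ρ ↔ ∃ l ∈ lShape z, ‖w - l‖ ≤ ρ * ‖z‖ := by
  constructor
  · rintro ⟨-, h⟩
    obtain ⟨l, hl, he⟩ := (isCompact_lShape z).exists_infDist_eq_dist ⟨0, zero_mem_lShape z⟩ w
    exact ⟨l, hl, by rw [← dist_eq_norm, ← he]; exact h⟩
  · rintro ⟨l, hl, h⟩
    exact ⟨hw, (Metric.infDist_le_dist_of_mem hl).trans (by rwa [dist_eq_norm])⟩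

theorem norm_le_of_mem_lNhd {z w : ℂ} {ρ : ℝ} (hw : w ∈ lNhd z ρ) : ‖w‖ ≤ (1 + ρ) * ‖z‖ := by
  obtain ⟨l, hl, h⟩ := (mem_lNhd_iff hw.1).1 hw
  have h1 := norm_le_of_mem_lShape hl
  have h2 := norm_le_insert' w l
  linarith

theorem norm_le_norm_of_abs_le {a b : ℂ} (hre : |a.re| ≤ |b.re|) (him : |a.im| ≤ |b.im|) :
    ‖a‖ ≤ ‖b‖ := by
  rw [Complex.norm_def, Complex.norm_def, Complex.normSq_apply, Complex.normSq_apply]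
  exact Real.sqrt_le_sqrt (add_le_add (abs_le_iff_mul_self_le.1 hre)
    (abs_le_iff_mul_self_le.1 him))

/-- A point of `ℍ` off the neighbourhood can be moved horizontally to infinity, to the left or to
the right, without meeting it: the direction is the one away from the vertical segment. -/
theorem exists_horizontal_ray {z w : ℂ} {ρ : ℝ} (hz : 0 < z.im) (hw : 0 < w.im)
    (hwL : w ∉ lNhd z ρ) :
    ∃ σ : ℝ, |σ| = 1 ∧ ∀ t : ℝ, 0 ≤ t → w + ((σ * t : ℝ) : ℂ) ∉ lNhd z ρ := by
  -- it suffices to bring each point of the L-shape closer when moving back along the ray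
  have key : ∀ σ : ℝ, (∀ l ∈ lShape z, ∀ t : ℝ, 0 ≤ t → ∃ l' ∈ lShape z,
      |w.re - l'.re| ≤ |w.re + σ * t - l.re| ∧ |w.im - l'.im| ≤ |w.im - l.im|) →
      ∀ t : ℝ, 0 ≤ t → w + ((σ * t : ℝ) : ℂ) ∉ lNhd z ρ := by
    intro σ h t ht hmem
    obtain ⟨l, hl, hle⟩ := (mem_lNhd_iff (by simpa using hw.le)).1 hmem
    obtain ⟨l', hl', h1, h2⟩ := h l hl t ht
    refine hwL ((mem_lNhd_iff hw.le).2 ⟨l', hl', le_trans ?_ hle⟩)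
    exact norm_le_norm_of_abs_le (by simpa using h1) (by simpa using h2)
  have hhor : ∀ l ∈ lShape z, l.re ≠ z.re → w.re ∈ uIcc 0 z.re →
      ∃ l' ∈ lShape z, l'.re = w.re ∧ l'.im = l.im := by
    intro l hl hne hmem
    have him : l.im = 0 := by
      rcases (mem_lShape_iff hz.le).1 hl with h | h
      · exact h.1
      · exact absurd h.1 hne
    exact ⟨(w.re : ℂ), (mem_lShape_iff hz.le).2 (Or.inl ⟨by simp, by simpa using hmem⟩), by simp,
      by simp [him]⟩
  have hre : ∀ l ∈ lShape z, l.re ∈ uIcc 0 z.re := by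
    intro l hl
    rcases (mem_lShape_iff hz.le).1 hl with h | h
    · exact h.2
    · rw [h.1]; exact right_mem_uIcc
  by_cases hR : (0 ≤ w.re ∧ z.re ≤ w.re) ∨ (z.re < w.re ∧ w.re < 0)
  · refine ⟨1, abs_one, key 1 fun l hl t ht => ?_⟩
    by_cases hlw : l.re ≤ w.re
    · refine ⟨l, hl, ?_, le_rfl⟩
      rw [abs_of_nonneg (by linarith), abs_of_nonneg (by linarith)]
      linarith
    · have h0 := hre l hl
      rw [mem_uIcc] at h0
      obtain ⟨l', hl', e1, e2⟩ := hhor l hl (by rcases hR with h | h <;> intro he <;> linarith)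
        (by rw [mem_uIcc]; right; constructor <;> rcases hR with h | h <;>
              rcases h0 with h0 | h0 <;> linarith)
      exact ⟨l', hl', by rw [e1, sub_self, abs_zero]; exact abs_nonneg _, by rw [e2]⟩
  · refine ⟨-1, by simp, key (-1) fun l hl t ht => ?_⟩
    by_cases hlw : w.re ≤ l.re
    · refine ⟨l, hl, ?_, le_rfl⟩
      rw [abs_of_nonpos (by linarith), abs_of_nonpos (by linarith)]
      linarith
    · have h0 := hre l hl
      rw [mem_uIcc] at h0
      push Not at hR hlw
      have hw0 : 0 ≤ w.re ∧ w.re ≤ z.re ∧ l.re ≠ z.re := by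
        by_cases hc : 0 ≤ w.re
        · have := hR.1 hc
          exact ⟨hc, this.le, by linarith [this]⟩
        · exfalso
          have hc' := not_le.1 hc
          have : w.re ≤ z.re := by
            by_contra h
            linarith [hR.2 (not_le.1 h)]
          rcases h0 with h0 | h0 <;> linarith
      obtain ⟨l', hl', e1, e2⟩ := hhor l hl hw0.2.2
        (by rw [mem_uIcc]; exact Or.inl ⟨hw0.1, hw0.2.1⟩)
      exact ⟨l', hl', by rw [e1, sub_self, abs_zero]; exact abs_nonneg _, by rw [e2]⟩

theorem mem_unboundedComponent_of_notMem_lNhd {z w : ℂ} {ρ : ℝ} {K : Set ℂ} (hz : 0 < z.im)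
    (hK : K ⊆ lNhd z ρ) (hw : w ∈ halfPlane) (hwL : w ∉ lNhd z ρ) :
    w ∈ unboundedComponent K := by
  obtain ⟨σ, hσ, hray⟩ := exists_horizontal_ray hz hw hwL
  refine ⟨⟨hw, fun h => hwL (hK h)⟩, fun hb => ?_⟩
  have hsub : (fun t : ℝ => w + ((σ * t : ℝ) : ℂ)) '' Ici 0 ⊆
      connectedComponentIn (halfPlane \ K) w := by
    refine IsPreconnected.subset_connectedComponentIn ?_ ⟨0, self_mem_Ici, by simp⟩ ?_
    · exact isPreconnected_Ici.image _ (by fun_prop)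
    · rintro _ ⟨t, ht, rfl⟩
      refine ⟨?_, fun h => hray t ht (hK h)⟩
      have : 0 < w.im := hw
      simpa [halfPlane] using this
  obtain ⟨C, hC⟩ := (hb.subset hsub).exists_norm_le
  have h1 := hC _ ⟨|C| + ‖w‖ + 1, by simp only [mem_Ici]; positivity, rfl⟩
  have h2 := norm_sub_le (w + ((σ * (|C| + ‖w‖ + 1) : ℝ) : ℂ)) w
  rw [add_sub_cancel_left, Complex.norm_real, norm_mul, Real.norm_eq_abs, hσ, one_mul,
    Real.norm_of_nonneg (by positivity)] at h2
  linarith [le_abs_self C]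

theorem isOpen_unboundedComponent {K : Set ℂ} (hK : IsClosed K) :
    IsOpen (unboundedComponent K) := by
  have ho : IsOpen (halfPlane \ K) := isOpen_halfPlane.sdiff hK
  rw [isOpen_iff_mem_nhds]
  rintro w ⟨hw, hwu⟩
  filter_upwards [(ho.connectedComponentIn (x := w)).mem_nhds (mem_connectedComponentIn hw)]
    with v hv
  refine ⟨connectedComponentIn_subset _ _ hv, ?_⟩
  rwa [← connectedComponentIn_eq hv]

/-- Points of `ℍ` in one of five quadrants or half planes avoid the neighbourhood. -/
theorem notMem_lNhd_of_quadrant {z v : ℂ} {ρ : ℝ} (hz : 0 < z.im) (hv : 0 ≤ v.im)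
    (h : max 0 z.re + ρ * ‖z‖ < v.re ∨ v.re < min 0 z.re - ρ * ‖z‖ ∨ z.im + ρ * ‖z‖ < v.im ∨
      (v.re < z.re - ρ * ‖z‖ ∧ ρ * ‖z‖ < v.im) ∨ (z.re + ρ * ‖z‖ < v.re ∧ ρ * ‖z‖ < v.im)) :
    v ∉ lNhd z ρ := by
  intro hmem
  obtain ⟨l, hl, hle⟩ := (mem_lNhd_iff hv).1 hmem
  have h1 := abs_le.1 ((Complex.abs_re_le_norm _).trans hle)
  have h2 := abs_le.1 ((Complex.abs_im_le_norm _).trans hle)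
  rw [Complex.sub_re] at h1
  rw [Complex.sub_im] at h2
  have h3 := le_max_left 0 z.re
  have h4 := le_max_right 0 z.re
  have h5 := min_le_left 0 z.re
  have h6 := min_le_right 0 z.re
  rcases (mem_lShape_iff hz.le).1 hl with ⟨e1, e2⟩ | ⟨e1, e2⟩
  · obtain ⟨e3, e4⟩ : min 0 z.re ≤ l.re ∧ l.re ≤ max 0 z.re := e2
    rcases h with h | h | h | h | h <;> linarith
  · rcases h with h | h | h | h | h <;> linarith [e2.1, e2.2]

/-- Points of `ℍ` off the neighbourhood of twice the width lie well inside one of the five quadrants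
or half planes avoiding the neighbourhood: `(5/4) √2 < 2`. -/
theorem quadrant_of_notMem_lNhd {z w : ℂ} {ρ : ℝ} (hρ : 0 ≤ ρ) (hz : 0 < z.im) (hw : 0 < w.im)
    (hwL : w ∉ lNhd z (2 * ρ)) :
    max 0 z.re + 5 / 4 * (ρ * ‖z‖) ≤ w.re ∨ w.re ≤ min 0 z.re - 5 / 4 * (ρ * ‖z‖) ∨
      z.im + 5 / 4 * (ρ * ‖z‖) ≤ w.im ∨
      (w.re ≤ z.re - 5 / 4 * (ρ * ‖z‖) ∧ 5 / 4 * (ρ * ‖z‖) ≤ w.im) ∨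
      (z.re + 5 / 4 * (ρ * ‖z‖) ≤ w.re ∧ 5 / 4 * (ρ * ‖z‖) ≤ w.im) := by
  have hm : 0 ≤ ρ * ‖z‖ := by positivity
  set m := ρ * ‖z‖ with hmdef
  by_contra hcon
  push Not at hcon
  obtain ⟨h1, h2, h3, h4, h5⟩ := hcon
  obtain ⟨l, hl, hre, him⟩ : ∃ l ∈ lShape z, |w.re - l.re| ≤ 5 / 4 * m ∧
      |w.im - l.im| ≤ 5 / 4 * m := by
    by_cases hq : 5 / 4 * m ≤ w.im
    · have h4' : z.re - 5 / 4 * m < w.re := by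
        by_contra h
        exact absurd hq (not_le.2 (h4 (not_lt.1 h)))
      have h5' : w.re < z.re + 5 / 4 * m := by
        by_contra h
        exact absurd hq (not_le.2 (h5 (not_lt.1 h)))
      refine ⟨⟨z.re, min w.im z.im⟩, (mem_lShape_iff hz.le).2
        (Or.inr ⟨rfl, le_min hw.le hz.le, min_le_right _ _⟩), ?_, ?_⟩
      · rw [abs_le]; constructor <;> simp only <;> linarith
      · simp only
        rw [abs_le]
        rcases min_cases w.im z.im with h | h <;> constructor <;> linarith
    · refine ⟨⟨max (min 0 z.re) (min w.re (max 0 z.re)), 0⟩, (mem_lShape_iff hz.le).2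
        (Or.inl ⟨rfl, le_max_left _ _, max_le min_le_max (min_le_right _ _)⟩), ?_, ?_⟩
      · simp only
        rw [abs_le]
        rcases max_cases (min 0 z.re) (min w.re (max 0 z.re)) with h | h <;>
          rcases min_cases w.re (max 0 z.re) with h' | h' <;> constructor <;> linarith
      · simp only [sub_zero]
        rw [abs_of_pos hw]
        linarith
  refine hwL ((mem_lNhd_iff hw.le).2 ⟨l, hl, ?_⟩)
  rw [mul_assoc, ← hmdef]
  refine abs_le_of_sq_le_sq' ?_ (by positivity) |>.2
  rw [Complex.sq_norm, Complex.normSq_apply, Complex.sub_re, Complex.sub_im]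
  have e1 := sq_le_sq' (abs_le.1 hre).1 (abs_le.1 hre).2
  have e2 := sq_le_sq' (abs_le.1 him).1 (abs_le.1 him).2
  nlinarith [sq_nonneg m]

/-! ### Estimates for the Loewner map -/

theorem IsLoewnerMap.isHydrodynamicMap {K : Set ℂ} {g : ℂ → ℂ} {z : ℂ} {ρ : ℝ}
    (hg : IsLoewnerMap K g) (hK : IsClosed K) (hz : 0 < z.im) (hρ : ρ ≤ 1 / 4)
    (hKL : K ⊆ lNhd z ρ) : IsHydrodynamicMap (unboundedComponent K) (2 * ‖z‖) g where
  radius_pos := by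
    have : z ≠ 0 := by rintro rfl; simp at hz
    positivity
  isOpen := isOpen_unboundedComponent hK
  subset := fun _ hw => hw.1.1
  mem_of_norm_gt := fun w hw hwR =>
    mem_unboundedComponent_of_notMem_lNhd hz hKL hw fun h => by
      have h1 := norm_le_of_mem_lNhd h
      nlinarith [norm_nonneg z]
  differentiableOn := hg.differentiableOn
  bijOn := hg.bijOn
  hydrodynamic := hg.hydrodynamic

variable {H : Set ℂ} {g : ℂ → ℂ} {z w : ℂ} {ρ : ℝ}

/-- Far from `z` this is the comparison with the Joukowsky map; elsewhere `w` lies well inside a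
quadrant or half plane disjoint from the neighbourhood, and the barrier there applies. -/
theorem IsHydrodynamicMap.mul_im_le_im (hg : IsHydrodynamicMap H (2 * ‖z‖) g)
    (hz : 0 < z.im) (hρ : 0 < ρ) (hρ4 : ρ ≤ 1 / 4)
    (hH : ∀ v ∈ halfPlane, v ∉ lNhd z ρ → v ∈ H) (hw : w ∈ halfPlane)
    (hwL : w ∉ lNhd z (2 * ρ)) : ρ / 256 * w.im ≤ (g w).im := by
  have hwim : 0 < w.im := hw
  have hN : 0 < ‖z‖ := by linarith [hg.radius_pos]
  rcases le_or_gt (2 * (2 * ‖z‖)) ‖w‖ with hfar | hnear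
  · have h := hg.le_im_of_norm_gt hw (by linarith)
    have h1 : (2 * ‖z‖) ^ 2 / ‖w‖ ^ 2 ≤ 1 / 4 := by
      rw [div_le_iff₀ (by nlinarith)]
      nlinarith
    nlinarith
  · set N := ‖z‖ with hNdef
    set m := ρ * N with hm
    have hmpos : 0 < m := by positivity
    have hmN : m ≤ N / 4 := by nlinarith
    have hzre := abs_le.1 (Complex.abs_re_le_norm z)
    have hwn : w.im ≤ ‖w‖ := (le_abs_self _).trans (Complex.abs_im_le_norm w)
    have hmax : max 0 z.re ≤ N := max_le hN.le hzre.2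
    have hmin : -N ≤ min 0 z.re := le_min (by linarith) hzre.1
    have hbar : ∀ α β s : ℝ, 0 ≤ s → (∀ v : ℂ, |v.re| ≤ 4 * N → α + β * v.re ≤ 8 * N) →
        (∀ v : ℂ, 0 < α + β * v.re → s < v.im → v ∉ lNhd z ρ) →
        m / 4 ≤ α + β * w.re → w.im / 5 ≤ w.im - s → ρ / 256 * w.im ≤ (g w).im := by
      intro α β s hs hM hL h1 h2
      have h := hg.barrier_le_im (α := α) (β := β) (s := s) (M := 8 * N) hs (by positivity)
        (fun v hv => hM v ((Complex.abs_re_le_norm v).trans (by linarith)))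
        (fun v hv1 hv2 _ => hH v (lt_of_le_of_lt hs hv2) (hL v hv1 hv2))
        (by linarith) (by linarith) hnear
      refine le_trans ?_ h
      calc ρ / 256 * w.im ≤ 3 / (4 * (8 * N)) * (m / 4 * (w.im / 5)) := by
            have : 3 / (4 * (8 * N)) * (m / 4 * (w.im / 5)) = 3 / 640 * (ρ * w.im) := by
              rw [hm]; field_simp; norm_num
            rw [this]
            nlinarith [mul_pos hρ hwim]
        _ ≤ _ := by
            have : 0 ≤ α + β * w.re := by linarith
            gcongr
    rcases quadrant_of_notMem_lNhd hρ.le hz hwim hwL with h | h | h | h | h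
    · refine hbar (-(max 0 z.re + m)) 1 0 le_rfl (fun v hv => ?_) (fun v hv1 hv2 => ?_)
        (by linarith) (by linarith)
      · linarith [(abs_le.1 hv).2, le_max_left 0 z.re]
      · exact notMem_lNhd_of_quadrant hz hv2.le (Or.inl (by linarith))
    · refine hbar (min 0 z.re - m) (-1) 0 le_rfl (fun v hv => ?_) (fun v hv1 hv2 => ?_)
        (by linarith) (by linarith)
      · linarith [(abs_le.1 hv).1, min_le_left 0 z.re]
      · exact notMem_lNhd_of_quadrant hz hv2.le (Or.inr (Or.inl (by linarith)))
    -- above `z` a half plane is used: the barrier is constant in `x`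
    · have hb := hg.barrier_le_im (α := N) (β := 0) (s := z.im + m) (M := N) (by positivity) hN
        (fun v _ => by linarith)
        (fun v _ hv2 _ => hH v (show 0 < v.im by linarith) (notMem_lNhd_of_quadrant hz (by linarith)
          (Or.inr (Or.inr (Or.inl hv2)))))
        (by linarith) (by linarith) hnear
      have e : 3 / (4 * N) * ((N + 0 * w.re) * (w.im - (z.im + m))) =
          3 / 4 * (w.im - (z.im + m)) := by field_simp; ring
      rw [e] at hb
      nlinarith
    · refine hbar (z.re - m) (-1) m hmpos.le (fun v hv => ?_) (fun v hv1 hv2 => ?_)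
        (by linarith [h.1]) (by linarith [h.2])
      · linarith [(abs_le.1 hv).1]
      · exact notMem_lNhd_of_quadrant hz (by linarith)
          (Or.inr (Or.inr (Or.inr (Or.inl ⟨by linarith, hv2⟩))))
    · refine hbar (-(z.re + m)) 1 m hmpos.le (fun v hv => ?_) (fun v hv1 hv2 => ?_)
        (by linarith [h.1]) (by linarith [h.2])
      · linarith [(abs_le.1 hv).2]
      · exact notMem_lNhd_of_quadrant hz (by linarith)
          (Or.inr (Or.inr (Or.inr (Or.inr ⟨by linarith, hv2⟩))))

/-- The disc of radius `(ρ / 4) Im w` around `w` stays in `ℍ` and off the neighbourhood, so that the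
Schwarz–Pick inequality applies on it. -/
theorem IsHydrodynamicMap.norm_deriv_le_div (hg : IsHydrodynamicMap H (2 * ‖z‖) g)
    (hρ : 0 < ρ) (hρ4 : ρ ≤ 1 / 4)
    (hH : ∀ v ∈ halfPlane, v ∉ lNhd z ρ → v ∈ H) (hw : w ∈ halfPlane)
    (hwL : w ∉ lNhd z (2 * ρ)) : ‖deriv g w‖ ≤ 8 / ρ := by
  have hwim : 0 < w.im := hw
  have hN : 0 < ‖z‖ := by linarith [hg.radius_pos]
  have hr : 0 < ρ / 4 * w.im := by positivity
  refine (hg.norm_deriv_le hr fun v hv => ?_).trans_eq (by field_simp; norm_num)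
  rw [mem_ball_iff_norm] at hv
  have h1 := abs_lt.1 ((Complex.abs_im_le_norm (v - w)).trans_lt hv)
  rw [Complex.sub_im] at h1
  have hvim : 0 < v.im := by nlinarith
  refine hH v hvim fun hmem => ?_
  rcases le_or_gt w.im (4 * ‖z‖) with hle | hgt
  · obtain ⟨l, hl, hlv⟩ := (mem_lNhd_iff hvim.le).1 hmem
    refine hwL ((mem_lNhd_iff hwim.le).2 ⟨l, hl, ?_⟩)
    have h2 := norm_sub_le_norm_sub_add_norm_sub w v l
    rw [norm_sub_rev w v] at h2
    nlinarith
  · have h2 := norm_le_of_mem_lNhd hmem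
    have h3 := (le_abs_self _).trans (Complex.abs_im_le_norm v)
    nlinarith

theorem IsHydrodynamicMap.norm_sub_le_mul (hg : IsHydrodynamicMap H (2 * ‖z‖) g) {u : ℂ}
    (hu : MapClusterPt u (𝓝[H] z) g) (hρ : 0 < ρ) (hwH : w ∈ H) (hwL : w ∉ lNhd z (2 * ρ)) :
    ‖g w - u‖ ≤ (1 + 8 / ρ) * ‖w‖ := by
  have hN : 0 < ‖z‖ := by linarith [hg.radius_pos]
  have hwim : 0 < w.im := hg.subset hwH
  -- the L-shape contains the origin, so `w` cannot be close to it
  have hwn : 2 * ρ * ‖z‖ < ‖w‖ := by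
    by_contra h
    exact hwL ((mem_lNhd_iff hwim.le).2 ⟨0, zero_mem_lShape z, by simpa using h⟩)
  have h1 := hg.norm_le_add hwH
  have h2 := hg.norm_le_of_mapClusterPt (by linarith) hu
  have h3 := _root_.norm_sub_le (g w) u
  have h4 : 16 * ‖z‖ ≤ 8 / ρ * ‖w‖ := by
    rw [div_mul_eq_mul_div, le_div_iff₀ hρ]
    linarith
  linarith

/-! ### The Green's function -/

/-- The exponent of `Im` is negative and the exponent of `sin arg` is positive for `0 < κ < 8`. -/
theorem rpow_mul_green_le_green {κ C : ℝ} (hκ : 0 < κ) (hκ8 : κ < 8) (hC : 0 < C) {ζ : ℂ}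
    (hw : 0 < w.im) (hζ : 0 < ζ.im) (him : ζ.im ≤ w.im)
    (harg : C * (w.im / ‖w‖) ≤ ζ.im / ‖ζ‖) :
    C ^ (4 * aParam κ - 1) * green κ w ≤ green κ ζ := by
  have hd : dim κ - 2 ≤ 0 := by unfold dim; linarith
  have ha : 0 ≤ 4 * aParam κ - 1 := by
    unfold aParam
    rw [sub_nonneg, ← mul_div_assoc, le_div_iff₀ hκ]
    linarith
  unfold green
  rw [Complex.sin_arg, Complex.sin_arg, mul_left_comm, ← Real.mul_rpow hC.le (by positivity)]
  exact mul_le_mul (Real.rpow_le_rpow_of_nonpos hζ him hd)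
    (Real.rpow_le_rpow (by positivity) harg ha) (by positivity) (by positivity)

end SLEGreen

theorem mainTheorem9 (κ : ℝ) (hκ : 0 < κ) (hκ8 : κ < 8) (ρ : ℝ) (hρ : 0 < ρ) (hρ4 : ρ ≤ 1 / 4) :
    ∃ c : ℝ, 0 < c ∧
      ∀ z w : ℂ, z ∈ SLEGreen.halfPlane →
        w ∈ SLEGreen.halfPlane \ SLEGreen.lNhd z (2 * ρ) →
      ∀ (T : ℝ) (γ : ℝ → ℂ), 0 ≤ T → ContinuousOn γ (Set.Icc 0 T) →
        γ 0 = 0 → γ T = z → γ '' Set.Icc 0 T ⊆ SLEGreen.lNhd z ρ →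
      ∀ (g : ℂ → ℂ) (u : ℝ), SLEGreen.IsLoewnerMap (γ '' Set.Icc 0 T) g →
        SLEGreen.IsBoundaryValue (γ '' Set.Icc 0 T) g z u →
        w ∈ SLEGreen.unboundedComponent (γ '' Set.Icc 0 T) ∧
        c⁻¹ * SLEGreen.green κ w ≤ SLEGreen.green κ (g w - u) ∧
        c⁻¹ ≤ ‖deriv g w‖ ∧ ‖deriv g w‖ ≤ c := by
  -- `C` bounds the ratio of `sin arg (g w - u)` to `sin arg w` from below
  set C : ℝ := ρ / 256 / (1 + 8 / ρ) with hC
  have hCpos : 0 < C := by positivity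
  set P : ℝ := C ^ (4 * SLEGreen.aParam κ - 1) with hP
  have hPpos : 0 < P := Real.rpow_pos_of_pos hCpos _
  refine ⟨max P⁻¹ (512 / ρ), lt_max_of_lt_left (inv_pos.2 hPpos), ?_⟩
  intro z w hz hw T γ hT hγ hγ0 hγT hγL g u hg hu
  have hz' : 0 < z.im := hz
  have hwim : 0 < w.im := hw.1
  have hKc : IsClosed (γ '' Icc 0 T) := (isCompact_Icc.image_of_continuousOn hγ).isClosed
  have hH : ∀ v ∈ SLEGreen.halfPlane, v ∉ SLEGreen.lNhd z ρ →
      v ∈ SLEGreen.unboundedComponent (γ '' Icc 0 T) := fun v hv hvL =>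
    SLEGreen.mem_unboundedComponent_of_notMem_lNhd hz' hγL hv hvL
  have hwL : w ∉ SLEGreen.lNhd z ρ := fun h =>
    hw.2 ⟨h.1, h.2.trans (by nlinarith [norm_nonneg z])⟩
  have hwH := hH w hw.1 hwL
  have hyd := hg.isHydrodynamicMap hKc hz' hρ4 hγL
  have him := hyd.mul_im_le_im hz' hρ hρ4 hH hw.1 hw.2
  have hdle := hyd.norm_deriv_le_div hρ hρ4 hH hw.1 hw.2
  have hled := hyd.le_norm_deriv hwH
  have hsub := hyd.norm_sub_le_mul hu hρ hwH hw.2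
  have hgpos := hyd.im_pos hwH
  have heq : (g w - u).im = (g w).im := by simp
  have hwpos : 0 < ‖w‖ := hwim.trans_le ((le_abs_self _).trans (Complex.abs_im_le_norm w))
  have hgupos : 0 < ‖g w - u‖ := by
    refine hgpos.trans_le ?_
    rw [← heq]
    exact (le_abs_self _).trans (Complex.abs_im_le_norm _)
  refine ⟨hwH, ?_, ?_, ?_⟩
  · have hgreen := SLEGreen.rpow_mul_green_le_green hκ hκ8 hCpos hwim (ζ := g w - u)
      (by rw [heq]; exact hgpos) (by rw [heq]; exact hyd.im_le hwH) (by
        rw [heq]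
        calc C * (w.im / ‖w‖) = ρ / 256 * w.im / ((1 + 8 / ρ) * ‖w‖) := by
              rw [hC]; field_simp
          _ ≤ (g w).im / ‖g w - u‖ := by gcongr)
    refine le_trans ?_ hgreen
    have h1 : 0 ≤ SLEGreen.green κ w := by
      unfold SLEGreen.green
      rw [Complex.sin_arg]
      positivity
    have h2 : (max P⁻¹ (512 / ρ))⁻¹ ≤ P := inv_le_of_inv_le₀ hPpos (le_max_left _ _)
    gcongr
  · calc (max P⁻¹ (512 / ρ))⁻¹ ≤ (512 / ρ)⁻¹ := by gcongr; exact le_max_right _ _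
      _ = ρ / 256 * w.im / (2 * w.im) := by field_simp; norm_num
      _ ≤ (g w).im / (2 * w.im) := by gcongr
      _ ≤ _ := hled
  · refine hdle.trans (le_trans ?_ (le_max_right _ _))
    gcongr
    norm_num
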